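/- For $N\ge 1$ let $e(t)=e^{2\pi i t}$ and $\Delta(x_1,\dots,x_n)=\prod_{1\le j<k\le n}(x_j-x_k)$. For a function $f$ of $N$ points of the unit circle put $$\mathbb{E}_{\mathrm{ACUE}(N)}[f]=\frac{1}{N!\,(2N)^N}\sum_{t_1,\dots,t_N} f(e(t_1),\dots,e(t_N))\,|\Delta(e(t_1),\dots,e(t_N))|^2,$$ each $t_j$ running over $\{0,\tfrac1{2N},\dots,\tfrac{2N-1}{2N}\}$, and $$\mathbb{E}_{\mathrm{CUE}(N)}[f]=\frac{1}{N!}\int_{[0,1]^N} f(e(t_1),\dots,e(t_N))\,|\Delta(e(t_1),\dots,e(t_N))|^2\,d^Nt .$$ Write $g$, respectively $G$, for the diagonal matrix of the $N$ points. Let $[\ell]_{2N}\in\{0,\dots,2N-1\}$ be the residue of the integer $\ell$ modulo $2N$, and let $H_{N,\ell}(v)=0$ if $[\ell]_{2N}\le N-1$ and $H_{N,\ell}(v)=v^{[\ell]_{2N}-N}$ if $[\ell]_{2N}\ge N$. **Theorem.** Let $N,K,L\ge 1$ be integers. For all $v_1,\dots,v_{K+L}\in\mathbb{C}$, $$\mathbb{E}_{\mathrm{ACUE}(N)}\Big[\det(g)^{-K}\prod_{k=1}^{K+L}\det(1+v_kg)\Big]=\frac{\det\big(\phi_i(v_j)\big)_{i,j=1}^{K+L}}{\Delta(v_1,\dots,v_{K+L})},$$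 where $$\phi_i(v)=\begin{cases} v^{N+L+K-i}-v^L H_{N,K-i}(v) & 1\le i\le K,\\ v^{K+L-i}-v^{L+N-1}H_{N,i-K-1}(1/v) & K+1\le i\le K+L.\end{cases}$$ The $\phi_i$ are polynomials in $v$ and the ratio on the right is a polynomial in $v_1,\dots,v_{K+L}$; where some of the $v_j$ coincide, the right-hand side means the value of this polynomial. If $K,L\le N$, then $\phi_i=\psi_i$ for all $1\le i\le K+L$, where $\psi_i(v)=v^{N+L+K-i}$ for $i\le K$ and $\psi_i(v)=v^{K+L-i}$ for $i\ge K+1$; for all $v_1,\dots,v_{K+L}\in\mathbb{C}$, $$\mathbb{E}_{\mathrm{ACUE}(N)}\Big[\det(g)^{-K}\prod_{k=1}^{K+L}\det(1+v_kg)\Big]=s_{\langle N^K\rangle}(v_1,\dots,v_{K+L})=\mathbb{E}_{\mathrm{CUE}(N)}\Big[\det(G)^{-K}\prod_{k=1}^{K+L}\det(1+v_kG)\Big],$$ where $s_{\langle N^K\rangle}=\det(\psi_i(v_j))/\Delta(v)$ is the Schur polynomial of the partition with $K$ parts equal to $N$; and for all $u_1,\dots,u_K,v_1,\dots,v_L\in\mathbb{C}$,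 $$\mathbb{E}_{\mathrm{ACUE}(N)}\Big[\prod_{k=1}^K\overline{\det(1-u_kg)}\prod_{l=1}^L\det(1-v_lg)\Big]=\mathbb{E}_{\mathrm{CUE}(N)}\Big[\prod_{k=1}^K\overline{\det(1-u_kG)}\prod_{l=1}^L\det(1-v_lG)\Big].$$ If $K>N$ or $L>N$, then there are $v_1,\dots,v_{K+L}\in\mathbb{C}$ with $$\mathbb{E}_{\mathrm{ACUE}(N)}\Big[\det(g)^{-K}\prod_{k=1}^{K+L}\det(1+v_kg)\Big]\ne\mathbb{E}_{\mathrm{CUE}(N)}\Big[\det(G)^{-K}\prod_{k=1}^{K+L}\det(1+v_kG)\Big].$$ -/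

import Mathlib

open scoped BigOperators

noncomputable section

namespace ACUE

/-- `Δ(x₁,…,xₙ) = ∏_{j<k} (x_j - x_k)`. -/
def vdm {R : Type*} [CommRing R] {n : ℕ} (x : Fin n → R) : R :=
  ∏ j : Fin n, ∏ k ∈ Finset.Ioi j, (x j - x k)

/-- `e(t) = exp(2πit)`. -/
def e (t : ℝ) : ℂ := Complex.exp (2 * (Real.pi : ℂ) * Complex.I * (t : ℂ))

/-- The `ACUE(N)` expectation of a function `f` of the `N` points: the points are `e(t_j)`, with each
`t_j` running over `{0, 1/(2N), …, (2N-1)/(2N)}`. -/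
def acueE (N : ℕ) (f : (Fin N → ℂ) → ℂ) : ℂ :=
  1 / (Nat.factorial N : ℂ) * (1 / (2 * (N : ℂ)) ^ N) *
    ∑ m : Fin N → Fin (2 * N),
      f (fun j => e (((m j : ℕ) : ℝ) / (2 * (N : ℝ)))) *
        ((‖vdm (fun j => e (((m j : ℕ) : ℝ) / (2 * (N : ℝ))))‖ ^ 2 : ℝ) : ℂ)

/-- The `CUE(N)` expectation of a function `f` of the `N` points. -/
def cueE (N : ℕ) (f : (Fin N → ℂ) → ℂ) : ℂ :=
  1 / (Nat.factorial N : ℂ) *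
    ∫ t in Set.Icc (0 : Fin N → ℝ) 1,
      f (fun j => e (t j)) * ((‖vdm (fun j => e (t j))‖ ^ 2 : ℝ) : ℂ)

/-- `det(1 + z g)`, where `g = diag(x₁,…,x_N)`. -/
def detOneAdd {N : ℕ} (z : ℂ) (x : Fin N → ℂ) : ℂ :=
  (1 + z • Matrix.diagonal x).det

/-- `det(g)^{-K} ∏_k det(1 + v_k g)`, where `g = diag(x₁,…,x_N)`. -/
def mixedProd {N n : ℕ} (K : ℕ) (v : Fin n → ℂ) (x : Fin N → ℂ) : ℂ :=
  (Matrix.diagonal x).det ^ (-(K : ℤ)) * ∏ k, detOneAdd (v k) x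

/-- `∏_k conj(det(1 - u_k g)) ∏_l det(1 - v_l g)`, where `g = diag(x₁,…,x_N)`. -/
def conjProd {N K L : ℕ} (u : Fin K → ℂ) (v : Fin L → ℂ) (x : Fin N → ℂ) : ℂ :=
  (∏ k, (starRingEnd ℂ) (detOneAdd (-u k) x)) * ∏ l, detOneAdd (-v l) x

/-- `H_{N,ℓ}(v)`: it is `0` if the residue `r` of `ℓ` modulo `2N` is less than `N`,
and `v^{r-N}` otherwise. -/
def H (N : ℕ) (l : ℤ) (v : ℂ) : ℂ :=
  if l % (2 * (N : ℤ)) < (N : ℤ) then 0 else v ^ (l % (2 * (N : ℤ)) - (N : ℤ))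

/-- `φ_i(v)`, for `1 ≤ i ≤ K + L` (no subtraction of naturals truncates for such `i`). -/
def phi (N K L i : ℕ) (v : ℂ) : ℂ :=
  if i ≤ K then v ^ (N + L + K - i) - v ^ L * H N ((K : ℤ) - (i : ℤ)) v
  else v ^ (K + L - i) - v ^ (L + N - 1) * H N ((i : ℤ) - (K : ℤ) - 1) (1 / v)

/-- `ψ_i(v)`, for `1 ≤ i ≤ K + L`: the analogue of `φ_i` for the CUE. -/
def psi (N K L i : ℕ) (v : ℂ) : ℂ :=
  if i ≤ K then v ^ (N + L + K - i) else v ^ (K + L - i)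

/-- `det(φ_i(v_j))_{i,j=1}^{K+L}`. -/
def phiDet (N K L : ℕ) (v : Fin (K + L) → ℂ) : ℂ :=
  (Matrix.of fun i j : Fin (K + L) => phi N K L ((i : ℕ) + 1) (v j)).det

/-- The partition `⟨N^K⟩ = (N,…,N,0,…,0)` with `K` parts equal to `N`, padded with zeros to
length `n`. -/
def rectPartition (N K n : ℕ) : Fin n → ℕ := fun i => if (i : ℕ) < K then N else 0

/-- `s` is the Schur polynomial `s_λ(X₁,…,Xₙ)`, the quotient
`det(X_j^{λ_i + n - i})_{i,j=1}^n / Δ(X₁,…,Xₙ)`. As `Δ(X₁,…,Xₙ)` is not a zero divisor, at most one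
`s` has this property. -/
def IsSchur {n : ℕ} (lam : Fin n → ℕ) (s : MvPolynomial (Fin n) ℂ) : Prop :=
  s * vdm (fun j => (MvPolynomial.X j : MvPolynomial (Fin n) ℂ)) =
    (Matrix.of fun i j : Fin n =>
      (MvPolynomial.X j : MvPolynomial (Fin n) ℂ) ^ (lam i + (n - 1 - (i : ℕ)))).det

end ACUE

end

open MeasureTheory

noncomputable section

namespace ACUE

/-! Write the points of the ensemble as `-z_j` with `z_j` on the unit circle. Then `det(1 + v g)` is
a product of the differences `v - z_j⁻¹` up to powers of `z_j`, and `|Δ(z)|² = Δ(z) Δ(z⁻¹)`. So the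
weighted integrand times `Δ(v)` is `Δ(z) (∏ z_j)^L` times one Vandermonde determinant in the
variables `z⁻¹` and `v` (`mixedProd_mul_vdm`).

Expanding only `Δ(z)` over permutations and integrating row by row turns each `z`-row into a row of
moments. The permutations contribute equally, which cancels `N!`. The `N` exponents `L, …, L+N-1`
produced by `Δ(z) (∏ z_j)^L` form a window. If the nonzero moments of order below `N` vanish, the
window block is the identity, and its Schur complement is `det (momentPhi i (v k))`
(`ensembleE_mixedProd_mul_vdm`).

The ensembles differ only in their moments: the `k`-th is the indicator of `2N ∣ k` for the ACUE and
of `k = 0` for the CUE. These give `phi` and `psi`. No exponent outside the window is congruent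
modulo `2N` to one inside when `K, L ≤ N`, so the averages agree. Otherwise such a pair exists, and
a Fourier coefficient on the torus of `v` detects the corresponding moment. -/

/-! ### Vandermonde products and the weighted integrand -/

theorem vdm_eq_prod_ite {R : Type*} [CommRing R] {n : ℕ} (x : Fin n → R) :
    vdm x = ∏ j : Fin n, ∏ k : Fin n, if j < k then x j - x k else 1 := by
  unfold vdm
  refine Finset.prod_congr rfl fun j _ => ?_
  rw [← Finset.prod_filter]
  congr 1
  ext k
  simp

theorem vdm_append {R : Type*} [CommRing R] {m n : ℕ} (a : Fin m → R) (b : Fin n → R) :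
    vdm (Fin.append a b) = vdm a * vdm b * ∏ i, ∏ j, (a i - b j) := by
  have h1 (i : Fin m) (j : Fin n) : Fin.castAdd n i < Fin.natAdd m j := by
    simp only [Fin.lt_def, Fin.val_castAdd, Fin.val_natAdd]; lia
  have h2 (i : Fin m) (j : Fin n) : ¬ Fin.natAdd m j < Fin.castAdd n i := (h1 i j).le.not_gt
  have h3 (i j : Fin m) : Fin.castAdd n i < Fin.castAdd n j ↔ i < j := Iff.rfl
  have h4 (i j : Fin n) : Fin.natAdd m i < Fin.natAdd m j ↔ i < j := by
    simp only [Fin.lt_def, Fin.val_natAdd, Nat.add_lt_add_iff_left]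
  simp only [vdm_eq_prod_ite, Fin.prod_univ_add, Fin.append_left, Fin.append_right, h1, h2, h3, h4,
    if_true, if_false, Finset.prod_const_one, Finset.prod_mul_distrib]
  ring

theorem vdm_eq_det {R : Type*} [CommRing R] {n : ℕ} (x : Fin n → R) :
    vdm x = (Matrix.of fun i j : Fin n => x i ^ (n - 1 - (j : ℕ))).det := by
  have h := Matrix.det_projVandermonde (fun _ => (1 : R)) x
  simp only [one_mul] at h
  rw [vdm, ← h]
  congr 1
  ext i j
  simp only [Matrix.projVandermonde_apply, one_pow, one_mul, Matrix.of_apply, Fin.val_rev]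
  congr 1
  lia

theorem vdm_ne_zero {n : ℕ} {v : Fin n → ℂ} (hv : Function.Injective v) : vdm v ≠ 0 := by
  refine Finset.prod_ne_zero_iff.2 fun j _ => Finset.prod_ne_zero_iff.2 fun k hk => ?_
  rw [Finset.mem_Ioi] at hk
  exact sub_ne_zero.2 fun h => hk.ne (hv h)

theorem vdm_neg_norm {n : ℕ} (z : Fin n → ℂ) : ‖vdm (fun j => -z j)‖ = ‖vdm z‖ := by
  simp only [vdm, norm_prod]
  refine Finset.prod_congr rfl fun j _ => Finset.prod_congr rfl fun k _ => ?_
  rw [← norm_neg]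
  congr 1
  ring

theorem vdm_map {R S : Type*} [CommRing R] [CommRing S] (f : R →+* S) {n : ℕ} (x : Fin n → R) :
    f (vdm x) = vdm (fun j => f (x j)) := by
  simp [vdm]

theorem norm_vdm_sq {n : ℕ} {z : Fin n → ℂ} (hz : ∀ j, ‖z j‖ = 1) :
    ((‖vdm z‖ ^ 2 : ℝ) : ℂ) = vdm z * vdm (fun j => (z j)⁻¹) := by
  have h : (fun j => (z j)⁻¹) = fun j => starRingEnd ℂ (z j) := by
    funext j
    exact Complex.inv_eq_conj (hz j)
  rw [h, ← vdm_map (starRingEnd ℂ), Complex.mul_conj, Complex.normSq_eq_norm_sq]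

theorem detOneAdd_eq {N : ℕ} (z : ℂ) (x : Fin N → ℂ) : detOneAdd z x = ∏ j, (1 + z * x j) := by
  have : (1 + z • Matrix.diagonal x : Matrix (Fin N) (Fin N) ℂ) =
      Matrix.diagonal fun j => 1 + z * x j := by
    rw [← Matrix.diagonal_smul, ← Matrix.diagonal_one, Matrix.diagonal_add]
    rfl
  rw [detOneAdd, this, Matrix.det_diagonal]

theorem mixedProd_eq {N n : ℕ} (K : ℕ) (v : Fin n → ℂ) (x : Fin N → ℂ) :
    mixedProd K v x = ((∏ j, x j) ^ K)⁻¹ * ∏ k, ∏ j, (1 + v k * x j) := by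
  simp [mixedProd, detOneAdd_eq, Matrix.det_diagonal]

/-- The exponents `L + N - 1, …, L`, followed by the exponents of `psi`. -/
def blockExp (N K L : ℕ) : Fin N ⊕ Fin (K + L) → ℕ :=
  Sum.elim (fun a => L + N - 1 - a)
    (fun i => if (i : ℕ) < K then N + L + K - 1 - i else K + L - 1 - i)

/-- The order in which the `N` points stand between the first `K` and the last `L` variables. -/
def blockEquiv (N K L : ℕ) : Fin N ⊕ Fin (K + L) ≃ Fin (K + (N + L)) where
  toFun := Sum.elim (fun a => Fin.natAdd K (Fin.castAdd L a))
    (Fin.append (fun i => Fin.castAdd (N + L) i) fun i => Fin.natAdd K (Fin.natAdd N i))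
  invFun := Fin.append (fun i => Sum.inr (Fin.castAdd L i))
    (Fin.append (fun a => Sum.inl a) fun i => Sum.inr (Fin.natAdd K i))
  left_inv := by
    rintro (a | i)
    · simp
    · induction i using Fin.addCases <;> simp
  right_inv := by
    intro c
    induction c using Fin.addCases with
    | left i => simp
    | right c => induction c using Fin.addCases <;> simp

/-- The descending exponents `K+N+L-1, …, 0` of the full Vandermonde matrix split into `K` large
ones, the window of `N`, and `L` small ones. -/
theorem blockEquiv_exp (N K L : ℕ) (c : Fin N ⊕ Fin (K + L)) :
    K + (N + L) - 1 - (blockEquiv N K L c : ℕ) = blockExp N K L c := by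
  rcases c with a | i
  · simp [blockEquiv, blockExp]; lia
  · induction i using Fin.addCases with
    | left i => simp [blockEquiv, blockExp]; lia
    | right i => simp [blockEquiv, blockExp]; lia

theorem vdm_append_append_eq_det {R : Type*} [CommRing R] {N K L : ℕ} (y : Fin N → R)
    (v : Fin (K + L) → R) :
    vdm (Fin.append (fun i => v (Fin.castAdd L i)) (Fin.append y fun i => v (Fin.natAdd K i))) =
      (Matrix.of fun r c => Sum.elim y v r ^ blockExp N K L c).det := by
  rw [vdm_eq_det, ← Matrix.det_submatrix_equiv_self (blockEquiv N K L)]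
  congr 1
  ext r c
  simp only [Matrix.submatrix_apply, Matrix.of_apply, blockEquiv_exp]
  congr 1
  rcases r with a | i
  · simp [blockEquiv]
  · induction i using Fin.addCases <;> simp [blockEquiv]

/-- Placing `z⁻¹` between the first `K` and the last `L` variables makes all signs cancel: each
early variable contributes `det(g)⁻¹ det(1 + v g)` with `det g = ∏ (-z_j)`, and each late one
contributes `(∏ z_j)⁻¹ det(1 + v g)`, whence the factor `(∏ z_j)^L`. -/
theorem mixedProd_mul_vdm {N K L : ℕ} (v : Fin (K + L) → ℂ) {z : Fin N → ℂ}
    (hz : ∀ j, ‖z j‖ = 1) :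
    mixedProd K v (fun j => -z j) * ((‖vdm (fun j => -z j)‖ ^ 2 : ℝ) : ℂ) * vdm v =
      vdm z * (∏ j, z j) ^ L *
        (Matrix.of fun r c => Sum.elim (fun j => (z j)⁻¹) v r ^ blockExp N K L c).det := by
  have hz0 (j) : z j ≠ 0 := fun h => by simpa [h] using hz j
  have hP : ∏ j, z j ≠ 0 := Finset.prod_ne_zero_iff.2 fun j _ => hz0 j
  have hv : v = Fin.append (fun i => v (Fin.castAdd L i)) fun i => v (Fin.natAdd K i) := by
    funext i
    induction i using Fin.addCases <;> simp
  have hvd : vdm v = _ := (congrArg vdm hv).trans (vdm_append _ _)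
  have h1 (i : Fin K) : ∏ j, (v (Fin.castAdd L i) - (z j)⁻¹) =
      (∏ j, -z j)⁻¹ * ∏ j, (1 + v (Fin.castAdd L i) * -z j) := by
    rw [← Finset.prod_inv_distrib, ← Finset.prod_mul_distrib]
    refine Finset.prod_congr rfl fun j _ => ?_
    have := hz0 j
    field_simp
    ring
  have h2 : ∏ j, ∏ i : Fin L, ((z j)⁻¹ - v (Fin.natAdd K i)) =
      ∏ i : Fin L, ((∏ j, z j)⁻¹ * ∏ j, (1 + v (Fin.natAdd K i) * -z j)) := by
    rw [Finset.prod_comm]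
    refine Finset.prod_congr rfl fun i _ => ?_
    rw [← Finset.prod_inv_distrib, ← Finset.prod_mul_distrib]
    refine Finset.prod_congr rfl fun j _ => ?_
    have := hz0 j
    field_simp
    ring
  rw [← vdm_append_append_eq_det, vdm_append, vdm_append, vdm_neg_norm, norm_vdm_sq hz,
    mixedProd_eq, hvd]
  simp only [Fin.prod_univ_add, Fin.append_left, Fin.append_right, h1, h2, Finset.prod_mul_distrib,
    Finset.prod_const, Finset.card_univ, Fintype.card_fin, inv_pow]
  field_simp

/-! ### Averages as determinants of moments -/

section Integral

variable {Ω : Type*} [MeasurableSpace Ω] (ν : Measure Ω) [IsProbabilityMeasure ν]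

theorem det_eq_sum_rows {n : Type*} [Fintype n] [DecidableEq n] (A : Matrix n n ℂ) :
    A.det = ∑ σ : Equiv.Perm n, ((Equiv.Perm.sign σ : ℤ) : ℂ) * ∏ i, A i (σ i) := by
  rw [← Matrix.det_transpose, Matrix.det_apply']
  rfl

theorem integral_det {ι : Type*} [Fintype ι] [DecidableEq ι] {F : ι → ι → Ω → ℂ}
    (hF : ∀ i c, Integrable (F i c) ν) :
    ∫ t, (Matrix.of fun i c => F i c (t i)).det ∂Measure.pi (fun _ : ι => ν) =
      (Matrix.of fun i c => ∫ ω, F i c ω ∂ν).det := by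
  simp only [det_eq_sum_rows, Matrix.of_apply]
  rw [integral_finsetSum _ fun σ _ =>
    (Integrable.fintype_prod fun i => hF i (σ i)).const_mul _]
  refine Finset.sum_congr rfl fun σ _ => ?_
  rw [integral_const_mul, integral_fintype_prod_eq_prod]

/-- Each random row depends on its own variable, so every term of the permutation expansion is a
product of functions of independent variables; the rows `R` are constants. -/
theorem integrable_integral_det_sumElim {ι κ : Type*} [Fintype ι] [DecidableEq ι] [Fintype κ]
    [DecidableEq κ] {F : ι → ι ⊕ κ → Ω → ℂ} (hF : ∀ i c, Integrable (F i c) ν)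
    (R : κ → ι ⊕ κ → ℂ) :
    Integrable (fun t => (Matrix.of (Sum.elim (fun i c => F i c (t i)) R)).det)
      (Measure.pi fun _ : ι => ν) ∧
    ∫ t, (Matrix.of (Sum.elim (fun i c => F i c (t i)) R)).det ∂Measure.pi (fun _ : ι => ν) =
      (Matrix.of (Sum.elim (fun i c => ∫ ω, F i c ω ∂ν) R)).det := by
  simp only [det_eq_sum_rows, Matrix.of_apply, Fintype.prod_sum_type, Sum.elim_inl, Sum.elim_inr]
  have h (σ : Equiv.Perm (ι ⊕ κ)) := ((Integrable.fintype_prod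
    (μ := fun _ => ν) fun i => hF i (σ (Sum.inl i))).mul_const
      (∏ k, R k (σ (Sum.inr k)))).const_mul (((Equiv.Perm.sign σ : ℤ) : ℂ))
  refine ⟨integrable_finsetSum _ fun σ _ => h σ, ?_⟩
  rw [integral_finsetSum _ fun σ _ => h σ]
  refine Finset.sum_congr rfl fun σ _ => ?_
  rw [integral_const_mul, integral_mul_const, integral_fintype_prod_eq_prod]

theorem integrable_of_measurable_of_norm_le {f : Ω → ℂ} (hf : Measurable f) {C : ℝ}
    (hC : ∀ ω, ‖f ω‖ ≤ C) : Integrable f ν :=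
  (integrable_const C).mono' hf.aestronglyMeasurable (Filter.Eventually.of_forall hC)

theorem integrable_zpow {Z : Ω → ℂ} (hZ : Measurable Z) (hn : ∀ ω, ‖Z ω‖ = 1) (k : ℤ) :
    Integrable (fun ω => Z ω ^ k) ν :=
  integrable_of_measurable_of_norm_le ν (hZ.pow_const k) (C := 1) fun ω => by simp [hn]

/-- The average over `N` points `X(t_j)`, `t_j` of law `ν`, weighted by `|Δ|² / N!`. -/
def ensembleE {Ω : Type*} [MeasurableSpace Ω] (ν : Measure Ω) (X : Ω → ℂ) (N : ℕ)
    (f : (Fin N → ℂ) → ℂ) : ℂ :=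
  1 / (Nat.factorial N : ℂ) *
    ∫ t : Fin N → Ω, f (fun j => X (t j)) * ((‖vdm (fun j => X (t j))‖ ^ 2 : ℝ) : ℂ)
      ∂Measure.pi fun _ => ν

/-- The determinantal kernel obtained from moments `M` by eliminating the window of exponents. -/
def momentPhi (N K L : ℕ) (M : ℤ → ℂ) (i : Fin (K + L)) (v : ℂ) : ℂ :=
  v ^ blockExp N K L (Sum.inr i) - ∑ a : Fin N, v ^ blockExp N K L (Sum.inl a) *
    M ((blockExp N K L (Sum.inl a) : ℤ) - (blockExp N K L (Sum.inr i) : ℤ))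

/-- The monomial of `Δ(z) (∏ z_j)^L` attached to `σ` scales row `j` of the determinant by `z_j` to
the window exponent indexed by `σ j`. -/
theorem vdm_mul_prod_pow_mul_det {N K L : ℕ} (v : Fin (K + L) → ℂ) {z : Fin N → ℂ}
    (hz : ∀ j, z j ≠ 0) :
    vdm z * (∏ j, z j) ^ L *
        (Matrix.of fun r c => Sum.elim (fun j => (z j)⁻¹) v r ^ blockExp N K L c).det =
      ∑ σ : Equiv.Perm (Fin N), ((Equiv.Perm.sign σ : ℤ) : ℂ) *
        (Matrix.of (Sum.elim (fun j c => z j ^ ((blockExp N K L (Sum.inl (σ j)) : ℤ) -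
          (blockExp N K L c : ℤ))) fun k c => v k ^ blockExp N K L c)).det := by
  rw [vdm_eq_det, det_eq_sum_rows, Finset.sum_mul, Finset.sum_mul]
  refine Finset.sum_congr rfl fun σ _ => ?_
  rw [mul_assoc, mul_assoc, ← mul_assoc (∏ i, _)]
  congr 1
  have h1 : (∏ i, (Matrix.of fun i j : Fin N => z i ^ (N - 1 - (j : ℕ))) i (σ i)) *
      (∏ j, z j) ^ L = ∏ r, Sum.elim (fun j => z j ^ blockExp N K L (Sum.inl (σ j)))
        (fun _ : Fin (K + L) => (1 : ℂ)) r := by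
    rw [Fintype.prod_sum_type, ← Finset.prod_pow, ← Finset.prod_mul_distrib]
    simp only [Sum.elim_inl, Sum.elim_inr, Finset.prod_const_one, mul_one, Matrix.of_apply,
      ← pow_add, blockExp]
    refine Finset.prod_congr rfl fun j _ => ?_
    congr 1
    lia
  rw [h1, ← Matrix.det_mul_column]
  congr 1
  ext r c
  rcases r with j | k
  · simp [zpow_sub₀ (hz j), div_eq_mul_inv]
  · simp

/-- Two window exponents differ by less than `N`, so `hM0` and `hM` make the upper left block the
identity; the Schur complement remains. -/
theorem det_block {N K L : ℕ} (M : ℤ → ℂ) (hM0 : M 0 = 1)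
    (hM : ∀ k : ℤ, k ≠ 0 → |k| < N → M k = 0) (v : Fin (K + L) → ℂ) :
    (Matrix.of (Sum.elim (fun j c => M ((blockExp N K L (Sum.inl j) : ℤ) -
          (blockExp N K L c : ℤ))) fun k c => v k ^ blockExp N K L c)).det =
      (Matrix.of fun i k => momentPhi N K L M i (v k)).det := by
  have h : Matrix.of (Sum.elim (fun j c => M ((blockExp N K L (Sum.inl j) : ℤ) -
          (blockExp N K L c : ℤ))) fun k c => v k ^ blockExp N K L c) =
      Matrix.fromBlocks 1
        (Matrix.of fun j i => M ((blockExp N K L (Sum.inl j) : ℤ) -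
          (blockExp N K L (Sum.inr i) : ℤ)))
        (Matrix.of fun k a => v k ^ blockExp N K L (Sum.inl a))
        (Matrix.of fun k i => v k ^ blockExp N K L (Sum.inr i)) := by
    ext r c
    rcases r with j | k <;> rcases c with a | i
    · simp only [Matrix.of_apply, Sum.elim_inl, Matrix.fromBlocks_apply₁₁]
      by_cases hja : j = a
      · rw [hja, sub_self, hM0, Matrix.one_apply_eq]
      · rw [Matrix.one_apply_ne hja]
        have : (j : ℕ) ≠ a := fun h => hja (Fin.ext h)
        apply hM <;> simp only [blockExp, Sum.elim_inl]
        · lia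
        · rw [abs_lt]; constructor <;> lia
    · simp
    · simp
    · simp
  rw [h, Matrix.det_fromBlocks_one₁₁, ← Matrix.det_transpose]
  congr 1

theorem ensembleE_mixedProd_mul_vdm {Z : Ω → ℂ} (hZ : Measurable Z) (hn : ∀ ω, ‖Z ω‖ = 1)
    {N : ℕ} (K L : ℕ) (hM : ∀ k : ℤ, k ≠ 0 → |k| < N → ∫ ω, Z ω ^ k ∂ν = 0)
    (v : Fin (K + L) → ℂ) :
    ensembleE ν (fun ω => -Z ω) N (mixedProd K v) * vdm v =
      (Matrix.of fun i k => momentPhi N K L (fun k => ∫ ω, Z ω ^ k ∂ν) i (v k)).det := by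
  have hz (ω) : Z ω ≠ 0 := fun h => by simpa [h] using hn ω
  rw [ensembleE, mul_assoc, ← integral_mul_const]
  simp only [mixedProd_mul_vdm v fun j => hn _, vdm_mul_prod_pow_mul_det v fun j => hz _]
  have h (σ : Equiv.Perm (Fin N)) := integrable_integral_det_sumElim ν
    (F := fun j c ω => Z ω ^ ((blockExp N K L (Sum.inl (σ j)) : ℤ) - (blockExp N K L c : ℤ)))
    (fun j c => integrable_zpow ν hZ hn _) fun k c => v k ^ blockExp N K L c
  rw [integral_finsetSum _ fun σ _ => (h σ).1.const_mul _]
  rw [← det_block (fun k => ∫ ω, Z ω ^ k ∂ν) (by simp) hM]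
  set D := Matrix.of (Sum.elim (fun j c => ∫ ω, Z ω ^ ((blockExp N K L (Sum.inl j) : ℤ) -
          (blockExp N K L c : ℤ)) ∂ν) fun k c => v k ^ blockExp N K L c) with hD
  -- Undoing `σ` on the moment rows costs a second factor `sign σ`, so all `N!` terms equal `D.det`.
  have h2 (σ : Equiv.Perm (Fin N)) : ((Equiv.Perm.sign σ : ℤ) : ℂ) *
      (Matrix.of (Sum.elim (fun j c => ∫ ω, Z ω ^ ((blockExp N K L (Sum.inl (σ j)) : ℤ) -
          (blockExp N K L c : ℤ)) ∂ν) fun k c => v k ^ blockExp N K L c)).det = D.det := by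
    have h3 : Matrix.of (Sum.elim (fun j c => ∫ ω, Z ω ^ ((blockExp N K L (Sum.inl (σ j)) : ℤ) -
          (blockExp N K L c : ℤ)) ∂ν) fun k c => v k ^ blockExp N K L c) =
        D.submatrix (Equiv.Perm.sumCongr σ 1) id := by
      ext r c
      rcases r with j | k <;> simp [hD]
    rw [h3, Matrix.det_permute, Equiv.Perm.sign_sumCongr, Equiv.Perm.sign_one, mul_one,
      ← mul_assoc, ← Int.cast_mul, ← Units.val_mul, Int.units_mul_self]
    simp
  simp only [integral_const_mul, (h _).2, h2, Finset.sum_const, Finset.card_univ,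
    Fintype.card_perm, Fintype.card_fin, nsmul_eq_mul]
  have : (Nat.factorial N : ℂ) ≠ 0 := by exact_mod_cast Nat.factorial_ne_zero N
  field_simp

end Integral

/-! ### Moments of the two ensembles -/

theorem continuous_e : Continuous e := by
  unfold e
  fun_prop

theorem norm_e (t : ℝ) : ‖e t‖ = 1 := by
  rw [e, show 2 * (Real.pi : ℂ) * Complex.I * (t : ℂ) = ((2 * Real.pi * t : ℝ) : ℂ) * Complex.I by
    push_cast; ring]
  exact Complex.norm_exp_ofReal_mul_I _

/-- Lebesgue measure on `[0, 1]`. -/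
def unitMeasure : Measure ℝ := volume.restrict (Set.Icc 0 1)

instance : IsProbabilityMeasure unitMeasure := ⟨by simp [unitMeasure]⟩

/-- The uniform probability measure on `2N` points. -/
def uniformMeasure (N : ℕ) : Measure (Fin (2 * N)) := (2 * N : ENNReal)⁻¹ • Measure.count

theorem isProbabilityMeasure_uniformMeasure {N : ℕ} (hN : 1 ≤ N) :
    IsProbabilityMeasure (uniformMeasure N) := by
  refine ⟨?_⟩
  have h : (2 * N : ENNReal) ≠ 0 := by simp; lia
  have h' : (2 * N : ENNReal) ≠ ⊤ := ENNReal.mul_ne_top (by simp) (by simp)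
  rw [uniformMeasure, Measure.smul_apply, Measure.count_univ]
  simpa using ENNReal.inv_mul_cancel h h'

theorem uniformMeasure_real_singleton {N : ℕ} (m : Fin (2 * N)) :
    (uniformMeasure N).real {m} = 1 / (2 * N) := by
  simp [uniformMeasure, Measure.real]

theorem integral_uniformMeasure {N : ℕ} (hN : 1 ≤ N) (f : Fin (2 * N) → ℂ) :
    ∫ m, f m ∂uniformMeasure N = 1 / (2 * N) * ∑ m, f m := by
  have := isProbabilityMeasure_uniformMeasure hN
  rw [integral_fintype Integrable.of_finite, Finset.mul_sum]
  refine Finset.sum_congr rfl fun m _ => ?_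
  rw [uniformMeasure_real_singleton, Complex.real_smul]
  push_cast
  rfl

theorem acueE_eq_ensembleE {N : ℕ} (hN : 1 ≤ N) (f : (Fin N → ℂ) → ℂ) :
    acueE N f = ensembleE (uniformMeasure N)
      (fun m => e (((m : ℕ) : ℝ) / (2 * (N : ℝ)))) N f := by
  have := isProbabilityMeasure_uniformMeasure hN
  rw [acueE, ensembleE, integral_fintype Integrable.of_finite, mul_assoc]
  congr 1
  rw [Finset.mul_sum]
  refine Finset.sum_congr rfl fun m _ => ?_
  rw [Measure.real, Measure.pi_singleton, ENNReal.toReal_prod, Complex.real_smul]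
  congr 1
  have h (i) : (uniformMeasure N {m i}).toReal = 1 / (2 * N) := uniformMeasure_real_singleton _
  simp only [h, Finset.prod_const, Finset.card_univ, Fintype.card_fin]
  simp only [one_div, ← inv_pow]
  push_cast
  rfl

theorem cueE_eq_ensembleE (N : ℕ) (f : (Fin N → ℂ) → ℂ) :
    cueE N f = ensembleE unitMeasure e N f := by
  rw [cueE, ensembleE]
  congr 2
  rw [unitMeasure, ← Measure.restrict_pi_pi, ← volume_pi, Set.pi_univ_Icc]
  rfl

theorem integral_e_zpow (k : ℤ) : ∫ t, e t ^ k ∂unitMeasure = if k = 0 then 1 else 0 := by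
  split_ifs with hk
  · simp [hk]
  · have hc : (2 * (Real.pi : ℂ) * Complex.I * k) ≠ 0 := by
      simp [hk, Real.pi_ne_zero, Complex.I_ne_zero]
    rw [unitMeasure, integral_Icc_eq_integral_Ioc, ← intervalIntegral.integral_of_le zero_le_one]
    have h (t : ℝ) : e t ^ k = Complex.exp (2 * (Real.pi : ℂ) * Complex.I * k * t) := by
      rw [e, ← Complex.exp_int_mul]
      congr 1
      ring
    simp only [h]
    rw [integral_exp_mul_complex hc]
    have h1 : Complex.exp (2 * (Real.pi : ℂ) * Complex.I * k * (1 : ℝ)) = 1 := by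
      rw [Complex.exp_eq_one_iff]
      exact ⟨k, by push_cast; ring⟩
    rw [h1]
    simp

theorem integral_neg_e_zpow (k : ℤ) : ∫ t, (-e t) ^ k ∂unitMeasure = if k = 0 then 1 else 0 := by
  have h (t : ℝ) : (-e t) ^ k = (-1) ^ k * e t ^ k := by rw [← mul_zpow, neg_one_mul]
  simp only [h, integral_const_mul, integral_e_zpow]
  split_ifs with hk <;> simp [hk]

theorem integral_neg_root_zpow {N : ℕ} (hN : 1 ≤ N) (k : ℤ) :
    ∫ m : Fin (2 * N), (-e (((m : ℕ) : ℝ) / (2 * (N : ℝ)))) ^ k ∂uniformMeasure N =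
      if (2 * N : ℤ) ∣ k then 1 else 0 := by
  have hN0 : (N : ℂ) ≠ 0 := by exact_mod_cast (by lia : N ≠ 0)
  set ζ : ℂ := Complex.exp (2 * Real.pi * Complex.I / ((2 * N : ℕ) : ℂ)) with hζ
  have hp : IsPrimitiveRoot ζ (2 * N) := Complex.isPrimitiveRoot_exp _ (by lia)
  have h (m : Fin (2 * N)) : (-e (((m : ℕ) : ℝ) / (2 * (N : ℝ)))) ^ k =
      (-1) ^ k * (ζ ^ k) ^ (m : ℕ) := by
    rw [← zpow_natCast, zpow_comm, ← mul_zpow, zpow_natCast, neg_one_mul, hζ, e,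
      ← Complex.exp_nat_mul]
    congr 3
    push_cast
    field_simp
  rw [integral_uniformMeasure hN]
  simp only [h, ← Finset.mul_sum]
  rw [Fin.sum_univ_eq_sum_range fun m => (ζ ^ k) ^ m]
  have hdvd : ζ ^ k = 1 ↔ (2 * N : ℤ) ∣ k := by
    rw [hp.zpow_eq_one_iff_dvd]
    push_cast
    rfl
  split_ifs with hk
  -- The sign from `-e` disappears because a multiple of `2N` is even.
  · rw [hdvd.2 hk, Even.neg_one_zpow (even_iff_two_dvd.2 ((Dvd.intro _ rfl).trans hk))]
    simp
    field_simp
  · rw [geom_sum_eq (fun h => hk (hdvd.1 h)), ← zpow_natCast, zpow_comm, zpow_natCast, hp.pow_eq_one]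
    simp

/-! ### Identification of the kernels with `phi` and `psi` -/

/-- The window is shorter than `2N`, so at most one of its exponents is congruent to `q`. As `q ≡ L
+ N + r`, it can only be `L + r - N`, which lies in the window exactly when `r ≥ N`. -/
theorem sum_pow_mul_dvd {N L q : ℕ} {r : ℤ} (hr0 : 0 ≤ r) (hr : r < 2 * N)
    (hq : (2 * N : ℤ) ∣ q - L - N - r) (v : ℂ) :
    ∑ a : Fin N, v ^ (L + N - 1 - a) *
      (if (2 * N : ℤ) ∣ ((L + N - 1 - a : ℕ) : ℤ) - (q : ℤ) then (1 : ℂ) else 0) =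
      if r < N then 0 else v ^ (L + (r - N).toNat) := by
  have key (a : Fin N) (h : (2 * N : ℤ) ∣ ((L + N - 1 - a : ℕ) : ℤ) - (q : ℤ)) :
      r = 2 * N - 1 - a := by
    have h1 := dvd_add h hq
    have h2 : (2 * N : ℤ) ∣ r - (2 * N - 1 - a) := by
      convert! dvd_sub ((dvd_neg (α := ℤ)).2 h1) (dvd_refl (2 * N : ℤ)) using 1
      lia
    have h3 := Int.eq_zero_of_abs_lt_dvd h2 (by rw [abs_lt]; constructor <;> lia)
    lia
  split_ifs with hrN
  · refine Finset.sum_eq_zero fun a _ => ?_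
    rw [if_neg, mul_zero]
    intro h
    have := key a h
    lia
  · rw [Finset.sum_eq_single (⟨(2 * N - 1 - r).toNat, by lia⟩ : Fin N)]
    · rw [if_pos, mul_one]
      · congr 1
        simp only
        lia
      · rw [← dvd_neg] at hq
        convert! dvd_sub hq (dvd_refl (2 * N : ℤ)) using 1
        simp only
        lia
    · intro a _ ha
      rw [if_neg, mul_zero]
      intro h
      have := key a h
      exact ha (Fin.ext (by simp only; lia))
    · simp

theorem momentPhi_eq_phi {N K L : ℕ} (hN : 1 ≤ N) (hL : 1 ≤ L) (i : Fin (K + L)) (v : ℂ) :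
    momentPhi N K L (fun k => if (2 * N : ℤ) ∣ k then 1 else 0) i v = phi N K L (i + 1) v := by
  have hN2 : (0 : ℤ) < 2 * N := by lia
  by_cases hi : (i : ℕ) < K
  · have hr0 := Int.emod_nonneg ((K : ℤ) - ((i : ℕ) + 1 : ℕ)) hN2.ne'
    have hr := Int.emod_lt_of_pos ((K : ℤ) - ((i : ℕ) + 1 : ℕ)) hN2
    have hd := Int.dvd_sub_self_of_emod_eq (a := (K : ℤ) - ((i : ℕ) + 1 : ℕ)) (b := 2 * (N : ℤ)) rfl
    rw [dvd_sub_comm] at hd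
    simp only [momentPhi, phi, H, blockExp, Sum.elim_inl, Sum.elim_inr, if_pos hi,
      if_pos (Nat.succ_le_of_lt hi)]
    set r := ((K : ℤ) - ((i : ℕ) + 1 : ℕ)) % (2 * (N : ℤ))
    rw [sum_pow_mul_dvd hr0 hr (by convert! hd using 1; lia)]
    congr 1
    · congr 1; lia
    · split_ifs with h
      · simp
      · rw [pow_add, ← zpow_natCast v (r - N).toNat, Int.toNat_of_nonneg (by lia)]
  · have hr0 := Int.emod_nonneg ((((i : ℕ) + 1 : ℕ) : ℤ) - K - 1) hN2.ne'
    have hr := Int.emod_lt_of_pos ((((i : ℕ) + 1 : ℕ) : ℤ) - K - 1) hN2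
    have hd := Int.dvd_sub_self_of_emod_eq (a := (((i : ℕ) + 1 : ℕ) : ℤ) - K - 1)
      (b := 2 * (N : ℤ)) rfl
    simp only [momentPhi, phi, H, blockExp, Sum.elim_inl, Sum.elim_inr, if_neg hi,
      if_neg (by lia : ¬ (i : ℕ) + 1 ≤ K)]
    set r := ((((i : ℕ) + 1 : ℕ) : ℤ) - K - 1) % (2 * (N : ℤ))
    -- Here `q - L - N ≡ N - 1 - r` modulo `2N`; the representative in `[0, 2N)` is `N - 1 - r` or
    -- `3N - 1 - r`, on the same side of `N` as `r`.
    by_cases h : r < N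
    · rw [sum_pow_mul_dvd (r := N - 1 - r) (by lia) (by lia)
        (by convert! dvd_sub hd (dvd_refl (2 * (N : ℤ))) using 1; lia), if_pos h, if_pos (by lia)]
      congr 1
      · congr 1; lia
      · simp
    · rw [sum_pow_mul_dvd (r := 3 * N - 1 - r) (by lia) (by lia)
        (by convert! dvd_sub (dvd_sub hd (dvd_refl (2 * (N : ℤ)))) (dvd_refl (2 * (N : ℤ))) using 1
            lia), if_neg h, if_neg (by lia)]
      congr 1
      · congr 1; lia
      · have hr' : (r - N) = ((r - N).toNat : ℤ) := (Int.toNat_of_nonneg (by lia)).symm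
        have he : L + N - 1 = (L + (3 * N - 1 - r - N).toNat) + (r - N).toNat := by lia
        rw [hr', zpow_natCast, he, pow_add v (L + _)]
        -- At `v = 0`, where `1 / v` is `0` by convention, both sides vanish because the exponent is
        -- at least `L ≥ 1`.
        rcases eq_or_ne v 0 with rfl | hv
        · rw [zero_pow (by lia), zero_mul, zero_mul]
        · rw [mul_assoc, ← mul_pow, mul_one_div_cancel hv, one_pow, mul_one]

theorem blockExp_injective {N K L : ℕ} : Function.Injective (blockExp N K L) := by
  intro a b h
  apply (blockEquiv N K L).injective
  rw [← blockEquiv_exp, ← blockEquiv_exp] at h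
  ext
  lia

theorem momentPhi_eq_psi {N K L : ℕ} (i : Fin (K + L)) (v : ℂ) :
    momentPhi N K L (fun k => if k = 0 then 1 else 0) i v = psi N K L (i + 1) v := by
  have h (a : Fin N) : ¬ ((blockExp N K L (Sum.inl a) : ℤ) -
      (blockExp N K L (Sum.inr i) : ℤ)) = 0 := by
    rw [sub_eq_zero, Nat.cast_inj]
    exact fun h => by simpa using blockExp_injective h
  simp only [momentPhi, h, if_false, mul_zero, Finset.sum_const_zero, sub_zero]
  simp only [psi, blockExp, Sum.elim_inr, Nat.succ_le_iff]
  split_ifs <;> congr 1 <;> lia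

theorem acueE_mixedProd_mul_vdm {N K L : ℕ} (hN : 1 ≤ N) (hL : 1 ≤ L)
    (v : Fin (K + L) → ℂ) :
    acueE N (mixedProd K v) * vdm v = phiDet N K L v := by
  have := isProbabilityMeasure_uniformMeasure hN
  have h := ensembleE_mixedProd_mul_vdm (uniformMeasure N)
    (Z := fun m => -e (((m : ℕ) : ℝ) / (2 * (N : ℝ)))) (N := N)
    (measurable_of_finite _) (fun m => by rw [norm_neg, norm_e]) K L ?_ v
  · simp only [neg_neg, integral_neg_root_zpow hN, momentPhi_eq_phi hN hL] at h
    rw [acueE_eq_ensembleE hN, h, phiDet]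
  · intro k hk hkN
    rw [integral_neg_root_zpow hN, if_neg]
    exact fun h => hk (Int.eq_zero_of_abs_lt_dvd h (by lia))

theorem cueE_mixedProd_mul_vdm {N K L : ℕ} (v : Fin (K + L) → ℂ) :
    cueE N (mixedProd K v) * vdm v =
      (Matrix.of fun i j : Fin (K + L) => psi N K L ((i : ℕ) + 1) (v j)).det := by
  have h := ensembleE_mixedProd_mul_vdm unitMeasure (Z := fun t => -e t) (N := N)
    continuous_e.neg.measurable (fun m => by rw [norm_neg, norm_e]) K L ?_ v
  · simp only [neg_neg, integral_neg_e_zpow, momentPhi_eq_psi] at h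
    rw [cueE_eq_ensembleE, h]
  · intro k hk hkN
    rw [integral_neg_e_zpow, if_neg hk]

/-! ### Coincident variables, polynomiality and agreement for `K, L ≤ N` -/

/-- On the line `v_j + t j` only finitely many `t` make two coordinates coincide, so equality
extends by density to `t = 0`. -/
theorem eq_of_continuous_of_injective {n : ℕ} {f g : (Fin n → ℂ) → ℂ} (hf : Continuous f)
    (hg : Continuous g) (h : ∀ v, Function.Injective v → f v = g v) : f = g := by
  funext v
  let a : ℂ → Fin n → ℂ := fun t j => v j + t * (j : ℕ)
  have ha : Continuous a := by fun_prop
  let S : Set ℂ := Set.range fun p : Fin n × Fin n =>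
    (v p.2 - v p.1) / (((p.1 : ℕ) : ℂ) - ((p.2 : ℕ) : ℂ))
  have hS : Dense Sᶜ := (Set.finite_range _).countable.dense_compl ℂ
  have key : f ∘ a = g ∘ a := by
    refine Continuous.ext_on hS (hf.comp ha) (hg.comp ha) fun t ht => h _ fun j k hjk => ?_
    by_contra hne
    refine ht ⟨(j, k), ?_⟩
    have h1 : ((j : ℕ) : ℂ) - ((k : ℕ) : ℂ) ≠ 0 := by
      rw [sub_ne_zero, Ne, Nat.cast_inj]
      exact fun h => hne (Fin.ext h)
    rw [div_eq_iff h1]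
    simp only [a] at hjk
    linear_combination -hjk
  simpa [a] using congrFun key 0

theorem acueE_continuous {X : Type*} [TopologicalSpace X] {N : ℕ} {F : X → (Fin N → ℂ) → ℂ}
    (hF : ∀ x : Fin N → ℂ, (∀ j, ‖x j‖ = 1) → Continuous fun p => F p x) :
    Continuous fun p => acueE N (F p) := by
  unfold acueE
  exact continuous_const.mul (continuous_finsetSum _ fun m _ =>
    (hF _ fun j => norm_e _).mul continuous_const)

theorem cueE_continuous {X : Type*} [TopologicalSpace X] [FirstCountableTopology X]
    [LocallyCompactSpace X] {N : ℕ} {F : X → (Fin N → ℂ) → ℂ}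
    (hF : Continuous fun p : X × (Fin N → ℝ) => F p.1 fun j => e (p.2 j)) :
    Continuous fun p => cueE N (F p) := by
  unfold cueE
  refine continuous_const.mul (continuous_parametric_integral_of_continuous ?_ isCompact_Icc)
  refine hF.mul ?_
  unfold vdm
  have := continuous_e
  fun_prop

theorem cueE_mixedProd_continuous (N K n : ℕ) :
    Continuous fun v : Fin n → ℂ => cueE N (mixedProd K v) := by
  apply cueE_continuous
  simp only [mixedProd_eq]
  have := continuous_e
  refine Continuous.mul (Continuous.inv₀ (by fun_prop) fun p => ?_) (by fun_prop)
  exact pow_ne_zero _ (Finset.prod_ne_zero_iff.2 fun j _ => Complex.exp_ne_zero _)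

/-- The `ACUE(N)` average of `mixedProd K` as a polynomial in the variables. -/
def acuePoly (N K n : ℕ) : MvPolynomial (Fin n) ℂ :=
  MvPolynomial.C (1 / (Nat.factorial N : ℂ) * (1 / (2 * (N : ℂ)) ^ N)) *
    ∑ m : Fin N → Fin (2 * N),
      MvPolynomial.C (((∏ j, e (((m j : ℕ) : ℝ) / (2 * (N : ℝ)))) ^ K)⁻¹) *
        (∏ k, ∏ j, (1 + MvPolynomial.X k * MvPolynomial.C (e (((m j : ℕ) : ℝ) / (2 * (N : ℝ)))))) *
        MvPolynomial.C ((‖vdm (fun j => e (((m j : ℕ) : ℝ) / (2 * (N : ℝ))))‖ ^ 2 : ℝ) : ℂ)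

/-- The ACUE average is a finite sum, hence visibly a polynomial in `v`; no divisibility of the
determinant by `Δ(v)` has to be proved. -/
theorem acueE_mixedProd_eq_eval (N K : ℕ) {n : ℕ} (v : Fin n → ℂ) :
    acueE N (mixedProd K v) = MvPolynomial.eval v (acuePoly N K n) := by
  simp only [acueE, acuePoly, mixedProd_eq, map_mul, map_sum, map_prod, map_add, map_one,
    MvPolynomial.eval_C, MvPolynomial.eval_X]

theorem cueE_eq_acueE_of_phi_eq_psi {N K L : ℕ} (hN : 1 ≤ N) (hL : 1 ≤ L)
    (h : ∀ i : ℕ, 1 ≤ i → i ≤ K + L → ∀ z : ℂ, phi N K L i z = psi N K L i z)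
    (v : Fin (K + L) → ℂ) : cueE N (mixedProd K v) = acueE N (mixedProd K v) := by
  refine congrFun (eq_of_continuous_of_injective (g := fun v => acueE N (mixedProd K v))
    (cueE_mixedProd_continuous N K _) ?_ fun v hv => ?_) v
  · simp only [acueE_mixedProd_eq_eval]
    exact MvPolynomial.continuous_eval _
  · refine mul_right_cancel₀ (vdm_ne_zero hv) ?_
    rw [cueE_mixedProd_mul_vdm, acueE_mixedProd_mul_vdm hN hL, phiDet]
    congr 2
    funext i j
    exact (h _ (by lia) (by lia) _).symm

theorem isSchur_acuePoly {N K L : ℕ} (hN : 1 ≤ N) (hL : 1 ≤ L)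
    (h : ∀ i : ℕ, 1 ≤ i → i ≤ K + L → ∀ z : ℂ, phi N K L i z = psi N K L i z) :
    IsSchur (rectPartition N K (K + L)) (acuePoly N K (K + L)) := by
  refine MvPolynomial.funext fun v => ?_
  rw [map_mul, vdm_map, RingHom.map_det]
  simp only [MvPolynomial.eval_X]
  rw [← acueE_mixedProd_eq_eval, acueE_mixedProd_mul_vdm hN hL, phiDet]
  congr 1
  ext i j
  simp only [Matrix.of_apply, RingHom.mapMatrix_apply, Matrix.map_apply, map_pow,
    MvPolynomial.eval_X, h _ (by lia : 1 ≤ (i : ℕ) + 1) (by lia), psi, rectPartition,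
    Nat.succ_le_iff]
  split_ifs <;> congr 1 <;> lia

theorem phi_eq_psi {N K L : ℕ} (hK : K ≤ N) (hL : L ≤ N) {i : ℕ} (hi : 1 ≤ i) (hi' : i ≤ K + L)
    (z : ℂ) : phi N K L i z = psi N K L i z := by
  unfold phi psi
  split_ifs with h
  · rw [H, Int.emod_eq_of_lt (by lia) (by lia), if_pos (by lia), mul_zero, sub_zero]
  · rw [H, Int.emod_eq_of_lt (by lia) (by lia), if_pos (by lia), mul_zero, sub_zero]

/-- On the unit circle `conj(1 - u x) = -ū x⁻¹ (1 - ū⁻¹ x)`, which needs `u ≠ 0`. -/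
theorem conjProd_eq_mixedProd {N K L : ℕ} {u : Fin K → ℂ} (v : Fin L → ℂ) (hu : ∀ k, u k ≠ 0)
    {x : Fin N → ℂ} (hx : ∀ j, ‖x j‖ = 1) :
    conjProd u v x = (∏ k, (-starRingEnd ℂ (u k)) ^ N) *
      mixedProd K (Fin.append (fun k => -(starRingEnd ℂ (u k))⁻¹) fun l => -v l) x := by
  have h (k : Fin K) : starRingEnd ℂ (detOneAdd (-u k) x) = (-starRingEnd ℂ (u k)) ^ N *
      ((∏ j, x j)⁻¹ * ∏ j, (1 + -(starRingEnd ℂ (u k))⁻¹ * x j)) := by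
    have hc : starRingEnd ℂ (u k) ≠ 0 := (map_ne_zero _).2 (hu k)
    have hN : (-starRingEnd ℂ (u k)) ^ N = ∏ _j : Fin N, (-starRingEnd ℂ (u k)) := by simp
    rw [detOneAdd_eq, map_prod, hN, ← Finset.prod_inv_distrib, ← Finset.prod_mul_distrib,
      ← Finset.prod_mul_distrib]
    refine Finset.prod_congr rfl fun j _ => ?_
    have hj : x j ≠ 0 := fun h => by simpa [h] using hx j
    rw [map_add, map_mul, map_neg, map_one, ← Complex.inv_eq_conj (hx j)]
    field_simp
    ring
  rw [conjProd, mixedProd_eq]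
  simp only [h, Fin.prod_univ_add, Fin.append_left, Fin.append_right]
  simp only [Finset.prod_mul_distrib, Finset.prod_const, Finset.card_univ, Fintype.card_fin,
    inv_pow, detOneAdd_eq]
  ring

theorem acueE_congr_mul {N : ℕ} {f g : (Fin N → ℂ) → ℂ} (c : ℂ)
    (h : ∀ x : Fin N → ℂ, (∀ j, ‖x j‖ = 1) → f x = c * g x) : acueE N f = c * acueE N g := by
  unfold acueE
  rw [mul_left_comm c]
  congr 1
  rw [Finset.mul_sum]
  refine Finset.sum_congr rfl fun m _ => ?_
  rw [h _ fun j => norm_e _, mul_assoc]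

theorem cueE_congr_mul {N : ℕ} {f g : (Fin N → ℂ) → ℂ} (c : ℂ)
    (h : ∀ x : Fin N → ℂ, (∀ j, ‖x j‖ = 1) → f x = c * g x) : cueE N f = c * cueE N g := by
  unfold cueE
  rw [mul_left_comm c]
  congr 1
  rw [← integral_const_mul]
  congr 1
  funext t
  rw [h _ fun j => norm_e _, mul_assoc]

theorem acueE_conjProd_eq_cueE {N K L : ℕ}
    (h : ∀ w : Fin (K + L) → ℂ, cueE N (mixedProd K w) = acueE N (mixedProd K w))
    (u : Fin K → ℂ) (v : Fin L → ℂ) : acueE N (conjProd u v) = cueE N (conjProd u v) := by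
  -- Vectors `u` with a zero entry are reached by continuity.
  have hd : Dense (Set.univ.pi fun _ : Fin K => ({0}ᶜ : Set ℂ)) :=
    dense_pi _ fun _ _ => dense_compl_singleton 0
  refine congrFun (Continuous.ext_on (f := fun u => acueE N (conjProd u v))
    (g := fun u => cueE N (conjProd u v)) hd (acueE_continuous fun x _ => ?_)
    (cueE_continuous ?_) fun u hu => ?_) u
  · simp only [conjProd, detOneAdd_eq]
    fun_prop
  · simp only [conjProd, detOneAdd_eq]
    have := continuous_e
    fun_prop
  · have hu' (k) : u k ≠ 0 := by simpa using hu k (Set.mem_univ k)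
    simp only
    rw [acueE_congr_mul _ fun x hx => conjProd_eq_mixedProd v hu' hx,
      cueE_congr_mul _ fun x hx => conjProd_eq_mixedProd v hu' hx, h]

/-! ### Fourier coefficients and the case `K > N` or `L > N` -/

theorem integral_e_zpow_mul_momentPhi {N K L : ℕ} (M : ℤ → ℂ) (c : Fin N ⊕ Fin (K + L))
    (i : Fin (K + L)) :
    Integrable (fun t => e t ^ (-(blockExp N K L c : ℤ)) * momentPhi N K L M i (e t))
      unitMeasure ∧
    ∫ t, e t ^ (-(blockExp N K L c : ℤ)) * momentPhi N K L M i (e t) ∂unitMeasure =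
      Sum.elim (fun a => -M ((blockExp N K L (Sum.inl a) : ℤ) -
        (blockExp N K L (Sum.inr i) : ℤ))) (Pi.single i 1) c := by
  have he (t) : e t ≠ 0 := Complex.exp_ne_zero _
  have h (t : ℝ) : e t ^ (-(blockExp N K L c : ℤ)) * momentPhi N K L M i (e t) =
      e t ^ ((blockExp N K L (Sum.inr i) : ℤ) - blockExp N K L c) -
        ∑ a : Fin N, e t ^ ((blockExp N K L (Sum.inl a) : ℤ) - blockExp N K L c) *
          M ((blockExp N K L (Sum.inl a) : ℤ) - (blockExp N K L (Sum.inr i) : ℤ)) := by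
    rw [momentPhi, mul_sub, Finset.mul_sum, ← zpow_natCast, ← zpow_add₀ (he t), neg_add_eq_sub]
    congr 1
    refine Finset.sum_congr rfl fun a _ => ?_
    rw [← mul_assoc, ← zpow_natCast, ← zpow_add₀ (he t), neg_add_eq_sub]
  have hi (k : ℤ) := integrable_zpow unitMeasure continuous_e.measurable norm_e k
  have hs := integrable_finsetSum Finset.univ fun (a : Fin N) _ =>
    (hi ((blockExp N K L (Sum.inl a) : ℤ) - blockExp N K L c)).mul_const
      (M ((blockExp N K L (Sum.inl a) : ℤ) - (blockExp N K L (Sum.inr i) : ℤ)))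
  simp only [h]
  refine ⟨(hi _).sub hs, ?_⟩
  rw [integral_sub (hi _) hs, integral_finsetSum _ fun a _ => (hi _).mul_const _]
  simp only [integral_mul_const, integral_e_zpow, sub_eq_zero, Nat.cast_inj,
    blockExp_injective.eq_iff]
  rcases c with a | k
  · simp
  · simp [Pi.single_apply, eq_comm]

/-- This isolates a single moment. The chosen monomial takes the leading exponent of every
`momentPhi i` with `i ≠ i₀` and a window exponent at `i₀`. The coefficient is then a determinant
equal to the identity outside row `i₀`, so only the diagonal entry of that row survives. -/
theorem integral_prod_zpow_mul_det {N K L : ℕ} (M : ℤ → ℂ) (a : Fin N) (i₀ : Fin (K + L)) :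
    ∫ t, (∏ k, e (t k) ^ (-(blockExp N K L
        (Function.update Sum.inr i₀ (Sum.inl a) k : Fin N ⊕ Fin (K + L)) : ℤ))) *
        (Matrix.of fun i k => momentPhi N K L M i (e (t k))).det
        ∂Measure.pi (fun _ : Fin (K + L) => unitMeasure) =
      -M ((blockExp N K L (Sum.inl a) : ℤ) - (blockExp N K L (Sum.inr i₀) : ℤ)) := by
  set c : Fin (K + L) → Fin N ⊕ Fin (K + L) := Function.update Sum.inr i₀ (Sum.inl a) with hc
  have h (t : Fin (K + L) → ℝ) : (∏ k, e (t k) ^ (-(blockExp N K L (c k) : ℤ))) *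
        (Matrix.of fun i k => momentPhi N K L M i (e (t k))).det =
      (Matrix.of fun k i => e (t k) ^ (-(blockExp N K L (c k) : ℤ)) *
        momentPhi N K L M i (e (t k))).det := by
    rw [← Matrix.det_transpose, ← Matrix.det_mul_column]
    rfl
  simp only [h]
  rw [integral_det unitMeasure (F := fun k i t => e t ^ (-(blockExp N K L (c k) : ℤ)) *
        momentPhi N K L M i (e t)) fun k i => (integral_e_zpow_mul_momentPhi M (c k) i).1]
  simp only [(integral_e_zpow_mul_momentPhi M _ _).2]
  set b : Fin (K + L) → ℂ := fun i => -M ((blockExp N K L (Sum.inl a) : ℤ) -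
    (blockExp N K L (Sum.inr i) : ℤ)) with hb
  have hm : (Matrix.of fun k i => Sum.elim (fun a => -M ((blockExp N K L (Sum.inl a) : ℤ) -
      (blockExp N K L (Sum.inr i) : ℤ))) (Pi.single i 1) (c k)) =
      ((1 : Matrix (Fin (K + L)) (Fin (K + L)) ℂ).updateCol i₀ b).transpose := by
    ext k i
    rw [Matrix.of_apply, Matrix.transpose_apply]
    by_cases hk : k = i₀
    · rw [hk, Matrix.updateCol_self, hc, Function.update_self, Sum.elim_inl]
    · rw [Matrix.updateCol_ne hk, hc, Function.update_of_ne hk, Sum.elim_inr, Matrix.one_apply,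
        Pi.single_apply]
      simp only [eq_comm]
  rw [hm, Matrix.det_transpose, ← Matrix.cramer_apply, Matrix.cramer_one]
  rfl

theorem exists_window_exponent {N K L : ℕ} (hN : 1 ≤ N) (h : N < K ∨ N < L) :
    ∃ (a : Fin N) (i : Fin (K + L)),
      (2 * N : ℤ) ∣ (blockExp N K L (Sum.inl a) : ℤ) - (blockExp N K L (Sum.inr i) : ℤ) := by
  rcases h with h | h
  -- The lowest window exponent `L` and the large exponent `L + 2N`, available since `K > N`.
  · refine ⟨⟨N - 1, by lia⟩, ⟨K - N - 1, by lia⟩, -1, ?_⟩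
    simp only [blockExp, Sum.elim_inl, Sum.elim_inr]
    rw [if_pos (by lia)]
    lia
  -- The highest window exponent `L + N - 1` and the small exponent `L - N - 1`, available since `L
  -- > N`.
  · refine ⟨⟨0, by lia⟩, ⟨K + N, by lia⟩, 1, ?_⟩
    simp only [blockExp, Sum.elim_inl, Sum.elim_inr]
    rw [if_neg (by lia)]
    lia

theorem exists_acueE_ne_cueE {N K L : ℕ} (hN : 1 ≤ N) (hL : 1 ≤ L) (h : N < K ∨ N < L) :
    ∃ v : Fin (K + L) → ℂ, acueE N (mixedProd K v) ≠ cueE N (mixedProd K v) := by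
  by_contra! hv
  obtain ⟨a, i, hai⟩ := exists_window_exponent hN h
  have hdet (w : Fin (K + L) → ℂ) :
      (Matrix.of fun i k => momentPhi N K L (fun k => if (2 * N : ℤ) ∣ k then 1 else 0) i
        (w k)).det =
      (Matrix.of fun i k => momentPhi N K L (fun k => if k = 0 then 1 else 0) i (w k)).det := by
    simp only [momentPhi_eq_phi hN hL, momentPhi_eq_psi]
    rw [← cueE_mixedProd_mul_vdm, ← hv, acueE_mixedProd_mul_vdm hN hL, phiDet]
  have h1 := integral_prod_zpow_mul_det (fun k => if (2 * N : ℤ) ∣ k then 1 else 0) a i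
  simp only [hdet] at h1
  -- The same coefficient would be `-1` from the ACUE moments and `0` from the CUE moments.
  rw [integral_prod_zpow_mul_det, if_pos hai, if_neg] at h1
  · simp at h1
  · rw [sub_eq_zero, Nat.cast_inj]
    exact fun h => by simpa using blockExp_injective h

end ACUE

end

theorem theorem1p2 (N K L : ℕ) (hN : 1 ≤ N) (hK : 1 ≤ K) (hL : 1 ≤ L) :
    -- the formula at distinct `v₁,…,v_{K+L}`, where `Δ(v) ≠ 0`
    (∀ v : Fin (K + L) → ℂ, Function.Injective v →
      ACUE.acueE N (ACUE.mixedProd K v) = ACUE.phiDet N K L v / ACUE.vdm v) ∧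
    -- the ratio is a polynomial, and read so the formula holds at every `v`
    (∃ P : MvPolynomial (Fin (K + L)) ℂ,
      (∀ w : Fin (K + L) → ℂ, MvPolynomial.eval w P * ACUE.vdm w = ACUE.phiDet N K L w) ∧
      ∀ v : Fin (K + L) → ℂ, ACUE.acueE N (ACUE.mixedProd K v) = MvPolynomial.eval v P) ∧
    -- for `K, L ≤ N` both averages are the Schur polynomial of `⟨N^K⟩`, and mixed moments agree
    (K ≤ N → L ≤ N →
      (∀ i : ℕ, 1 ≤ i → i ≤ K + L → ∀ z : ℂ, ACUE.phi N K L i z = ACUE.psi N K L i z) ∧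
      (∃ s : MvPolynomial (Fin (K + L)) ℂ,
        ACUE.IsSchur (ACUE.rectPartition N K (K + L)) s ∧
        ∀ v : Fin (K + L) → ℂ,
          ACUE.acueE N (ACUE.mixedProd K v) = MvPolynomial.eval v s ∧
          ACUE.cueE N (ACUE.mixedProd K v) = MvPolynomial.eval v s) ∧
      ∀ (u : Fin K → ℂ) (v : Fin L → ℂ),
        ACUE.acueE N (ACUE.conjProd u v) = ACUE.cueE N (ACUE.conjProd u v)) ∧
    -- otherwise the ACUE and CUE averages are different functions of `v`
    (N < K ∨ N < L →
      ∃ v : Fin (K + L) → ℂ,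
        ACUE.acueE N (ACUE.mixedProd K v) ≠ ACUE.cueE N (ACUE.mixedProd K v)) := by
  refine ⟨fun v hv => ?_, ⟨ACUE.acuePoly N K (K + L), fun w => ?_, ACUE.acueE_mixedProd_eq_eval N K⟩,
    fun hKN hLN => ?_, ACUE.exists_acueE_ne_cueE hN hL⟩
  · rw [eq_div_iff (ACUE.vdm_ne_zero hv), ACUE.acueE_mixedProd_mul_vdm hN hL]
  · rw [← ACUE.acueE_mixedProd_eq_eval, ACUE.acueE_mixedProd_mul_vdm hN hL]
  · have hphi : ∀ i : ℕ, 1 ≤ i → i ≤ K + L → ∀ z : ℂ, ACUE.phi N K L i z = ACUE.psi N K L i z :=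
      fun i hi hi' z => ACUE.phi_eq_psi hKN hLN hi hi' z
    have hcue := ACUE.cueE_eq_acueE_of_phi_eq_psi hN hL hphi
    refine ⟨hphi, ⟨ACUE.acuePoly N K (K + L), ACUE.isSchur_acuePoly hN hL hphi, fun v =>
      ⟨ACUE.acueE_mixedProd_eq_eval N K v, ?_⟩⟩, ACUE.acueE_conjProd_eq_cueE hcue⟩
    rw [hcue, ACUE.acueE_mixedProd_eq_eval]
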